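/- Let $k$ be a field, let $S$ be a finite semigroup (not necessarily with an identity element), and let $V$ be a finite-dimensional $kS$-module, that is, a finite-dimensional $k$-vector space with a semigroup homomorphism $S\to\operatorname{End}_k(V)$. For $n\ge 0$ let $S$ act diagonally on $V^{\otimes n}$, i.e. $s(v_1\otimes\cdots\otimes v_n)=sv_1\otimes\cdots\otimes sv_n$. Let $b(n)$ be the number of indecomposable direct summands of the $kS$-module $V^{\otimes n}$, counted with multiplicity (that is, the number of summands in a decomposition of $V^{\otimes n}$ as a direct sum of indecomposable $kS$-submodules), and let $l(n)$ be its length, i.e. the number of composition factors of $V^{\otimes n}$ counted with multiplicity. For functions $f,g:\mathbb{N}\to\mathbb{R}$ write $f\in\Theta'(g)$ if there are a constant $A\in\mathbb{R}_{>0}$ and $n_0\in\mathbb{N}$ such that $A\cdot g(n)\le f(n)\le g(n)$ for all $n>n_0$. Then $$b(n),\,l(n)\in\Theta'\big((\dim_k V)^n\big),$$ and $b(n)\le l(n)$ for all $n\ge 0$. In particular, there are $A>0$ and $n_0$ with $A(\dim_k V)^n\le b(n)\le l(n)\le(\dim_k V)^n$ for all $n>n_0$. -/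

import Mathlib

open scoped TensorProduct

/-- `f ∈ Θ'(g)`: there is a constant `A > 0` with `A * g n ≤ f n ≤ g n` for all `n > n₀`, for some
fixed `n₀`. -/
def InThetaPrime (f g : ℕ → ℝ) : Prop :=
  ∃ A : ℝ, 0 < A ∧ ∃ n₀ : ℕ, ∀ n : ℕ, n₀ < n → A * g n ≤ f n ∧ f n ≤ g n

/-- A module is indecomposable if it is nonzero and is not the direct sum of two nonzero
submodules. -/
def IsIndecomposableModule (R M : Type*) [Ring R] [AddCommGroup M] [Module R M] : Prop :=
  Nontrivial M ∧ ∀ A B : Submodule R M, IsCompl A B → A = ⊥ ∨ B = ⊥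

/-- The number of summands, counted with multiplicity, in a decomposition of `M` as a direct sum of
finitely many indecomposable submodules. For modules of finite length (in particular, for modules
over a `k`-algebra that are finite dimensional over the field `k`) such decompositions exist, and by
the Krull–Schmidt theorem they all have the same number of summands; formally the supremum over all
such decompositions is taken. -/
noncomputable def numIndecomposableSummands (R M : Type*) [Ring R] [AddCommGroup M] [Module R M] :
    ℕ :=
  sSup {m : ℕ | ∃ N : Fin m → Submodule R M,
    (∀ i, IsIndecomposableModule R (N i)) ∧ DirectSum.IsInternal N}

section SemigroupModules

variable {k S V : Type*} [Field k] [Semigroup S] [AddCommGroup V] [Module k V]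

/-- A `kS`-module structure on the `k`-vector space `V`, for a semigroup `S` (which need not have an
identity element), is a semigroup homomorphism `S → End_k(V)`. It is the same as a unital module over
the algebra of the monoid `WithOne S` obtained by adjoining an identity element to `S`; this is the
corresponding representation. The two have the same submodules and homomorphisms. -/
def semigroupRep (ρ : S →ₙ* Module.End k V) : Representation k (WithOne S) V :=
  WithOne.lift ρ

/-- The tensor power `V^{⊗n}` of a `kS`-module `V`, on which every element `s` of `S` acts
diagonally: `s • (v₁ ⊗ ⋯ ⊗ vₙ) = (s • v₁) ⊗ ⋯ ⊗ (s • vₙ)`. -/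
noncomputable def semigroupTensorPower (ρ : S →ₙ* Module.End k V) (n : ℕ) :
    S →ₙ* Module.End k (⨂[k]^n V) where
  toFun s := PiTensorProduct.map fun _ => ρ s
  map_mul' s t := by
    rw [map_mul]
    exact PiTensorProduct.map_mul (fun _ => ρ s) (fun _ => ρ t)

/-- `b(n)`: the number of indecomposable summands, counted with multiplicity, of the `kS`-module
`V^{⊗n}`. -/
noncomputable def summandCount (ρ : S →ₙ* Module.End k V) (n : ℕ) : ℕ :=
  numIndecomposableSummands (MonoidAlgebra k (WithOne S))
    (semigroupRep (semigroupTensorPower ρ n)).asModule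

/-- `l(n)`: the length, that is, the number of composition factors counted with multiplicity, of the
`kS`-module `V^{⊗n}` (which is finite if `V` is finite dimensional). -/
noncomputable def lengthCount (ρ : S →ₙ* Module.End k V) (n : ℕ) : ℕ :=
  (Module.length (MonoidAlgebra k (WithOne S))
    (semigroupRep (semigroupTensorPower ρ n)).asModule).toNat

end SemigroupModules

/-! The upper bounds hold because a decomposition into `m` nonzero summands has `m` at most the
length, and the length is at most the dimension. For the lower bound it suffices to find an `m` such
that `V^{⊗(m+n)}` carries `d ^ n` nonzero orthogonal idempotent endomorphisms, where `d = dim V`;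
then `A = d⁻ᵐ` works.

Let `E` be the finite monoid of endomorphisms generated by the image of `S` and the identity. A
block of `m = 2|E|` fixed tensor factors is chosen so that every nonunit of `E` kills the block
vector and is killed by the block functional, while every nonscalar unit has matrix coefficient zero
(`Submonoid.exists_dual_families`). Appending basis tensors of `V^{⊗n}` gives dual families `w j`,
`f i` with the same properties. Summing `x ↦ f i (h⁻¹ x) • h (w i)` over the units `h` gives an
`E`-equivariant map, to which nonunits are no obstacle. On the `w j` only scalar units contribute,
so it acts as `|Z| δ_ij`, where `Z` is the group of scalar units. Its order is invertible in `k`,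
because a field of characteristic `p` has no element of order `p` in its unit group. Dividing by
`|Z|` yields the idempotents. -/

/-! ### Counting summands by orthogonal idempotents. -/

section IndecomposableSummands

variable {R M : Type*} [Ring R] [AddCommGroup M] [Module R M]

theorem DirectSum.IsInternal.card_le_length {m : ℕ} {N : Fin m → Submodule R M}
    (hN : DirectSum.IsInternal N) (hne : ∀ i, N i ≠ ⊥) : (m : ℕ∞) ≤ Module.length R M := by
  have e : (∀ i, N i) ≃ₗ[R] M :=
    (DirectSum.linearEquivFunOnFintype R (Fin m) (fun i => N i)).symm.trans
      (LinearEquiv.ofBijective (DirectSum.coeLinearMap N) hN)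
  rw [← e.length_eq, Module.length_pi_of_fintype]
  calc (m : ℕ∞) = ∑ _i : Fin m, 1 := by simp
    _ ≤ _ := Finset.sum_le_sum fun i _ => by
      have := Submodule.nontrivial_iff_ne_bot.2 (hne i)
      exact Order.one_le_iff_pos.2 Module.length_pos

theorem IsIndecomposableModule.ne_bot {N : Submodule R M}
    (h : IsIndecomposableModule R N) : N ≠ ⊥ :=
  Submodule.nontrivial_iff_ne_bot.1 h.1

theorem numIndecomposableSummands_le_length (h : Module.length R M ≠ ⊤) :
    numIndecomposableSummands R M ≤ (Module.length R M).toNat := by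
  refine csSup_le' ?_
  rintro m ⟨N, hind, hN⟩
  have := hN.card_le_length fun i => (hind i).ne_bot
  exact ENat.natCast_le_natCast.1 (by rwa [ENat.natCast_toNat h])

theorem Finpartition.exists_isInternal (P : Finpartition (⊤ : Submodule R M)) :
    ∃ N : Fin P.parts.card → Submodule R M, (∀ i, N i ∈ P.parts) ∧ DirectSum.IsInternal N := by
  let e := P.parts.equivFin.symm
  have hind : iSupIndep (fun i : P.parts => (i : Submodule R M)) :=
    iSupIndep_iff_supIndep_univ.2
      (by simpa using (Finset.supIndep_attach (s := P.parts) (f := id)).2 P.supIndep)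
  refine ⟨fun i => (e i : Submodule R M), fun i => (e i).2,
    DirectSum.isInternal_submodule_of_iSupIndep_of_iSup_eq_top (hind.comp e.injective) ?_⟩
  rw [e.iSup_comp (g := fun i : P.parts => (i : Submodule R M)), iSup_subtype]
  exact (Finset.sup_eq_iSup P.parts id).symm.trans P.sup_parts

/-- A decomposable part can be replaced by its two nonzero complementary pieces. -/
theorem Finpartition.exists_card_lt [DecidableEq (Submodule R M)]
    (P : Finpartition (⊤ : Submodule R M))
    {N : Submodule R M} (hN : N ∈ P.parts) (hdec : ¬ IsIndecomposableModule R N) :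
    ∃ Q : Finpartition (⊤ : Submodule R M), P.parts.card < Q.parts.card := by
  have hnt := Submodule.nontrivial_iff_ne_bot.2 (P.ne_bot hN)
  simp only [IsIndecomposableModule, hnt, true_and, not_forall, not_or] at hdec
  obtain ⟨A, B, hAB, hA, hB⟩ := hdec
  have hinj : Function.Injective N.subtype := N.injective_subtype
  have hbot {C : Submodule R N} (hC : C ≠ ⊥) : C.map N.subtype ≠ ⊥ := fun h =>
    hC (Submodule.map_injective_of_injective hinj (by rw [h, Submodule.map_bot]))
  have hdis : Disjoint (A.map N.subtype) (B.map N.subtype) :=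
    Submodule.disjoint_map hinj hAB.disjoint
  have hsup : A.map N.subtype ⊔ B.map N.subtype = N := by
    rw [← Submodule.map_sup, hAB.sup_eq_top, Submodule.map_subtype_top]
  let split : Finpartition N := (Finpartition.indiscrete (hbot hA)).extend (hbot hB) hdis hsup
  have hsplit : split.parts.card = 2 := Finpartition.card_extend _ _ _
  refine ⟨P.bind fun i hi =>
    if h : N = i then split.copy h else Finpartition.indiscrete (P.ne_bot hi), ?_⟩
  rw [Finpartition.card_bind, ← Finset.card_attach, Finset.card_eq_sum_ones]
  refine Finset.sum_lt_sum (fun i _ => ?_) ⟨⟨N, hN⟩, Finset.mem_attach _ _, ?_⟩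
  · split_ifs
    · simp [hsplit]
    · simp
  · simp [hsplit]

/-- Finite length bounds the number of parts, and a partition with the most parts has only
indecomposable ones. Since the count is a supremum, Krull–Schmidt is not needed. -/
theorem Finpartition.card_le_numIndecomposableSummands (h : Module.length R M ≠ ⊤)
    (P : Finpartition (⊤ : Submodule R M)) : P.parts.card ≤ numIndecomposableSummands R M := by
  classical
  have hlen (Q : Finpartition (⊤ : Submodule R M)) :
      Q.parts.card ≤ (Module.length R M).toNat := by
    obtain ⟨N, hN, hint⟩ := Q.exists_isInternal
    exact ENat.natCast_le_natCast.1 (by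
      rw [ENat.natCast_toNat h]
      exact hint.card_le_length fun i => Q.ne_bot (hN i))
  have hfin : (Set.range fun Q : Finpartition (⊤ : Submodule R M) => Q.parts.card).Finite :=
    (Set.finite_Iic _).subset (Set.range_subset_iff.2 hlen)
  obtain ⟨_, ⟨Q, rfl⟩, hQ⟩ := hfin.exists_maximal ⟨_, P, rfl⟩
  have hmax (Q' : Finpartition (⊤ : Submodule R M)) : Q'.parts.card ≤ Q.parts.card :=
    not_lt.1 fun hlt => hlt.not_ge (hQ ⟨Q', rfl⟩ hlt.le)
  obtain ⟨N, hN, hint⟩ := Q.exists_isInternal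
  refine (hmax P).trans (le_csSup ⟨(Module.length R M).toNat, ?_⟩ ⟨N, fun i => ?_, hint⟩)
  · rintro m ⟨N, hind, hN⟩
    exact ENat.natCast_le_natCast.1 (by
      rw [ENat.natCast_toNat h]
      exact hN.card_le_length fun i => (hind i).ne_bot)
  · by_contra hdec
    obtain ⟨Q', hQ'⟩ := Q.exists_card_lt (hN i) hdec
    exact hQ'.not_ge (hmax Q')

/-- The ranges of the idempotents, together with the kernel of their sum, decompose the module. -/
theorem OrthogonalIdempotents.card_le_numIndecomposableSummands {ι : Type*} [Fintype ι]
    (h : Module.length R M ≠ ⊤) {P : ι → Module.End R M} (hP : OrthogonalIdempotents P)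
    (hne : ∀ i, P i ≠ 0) : Fintype.card ι ≤ numIndecomposableSummands R M := by
  classical
  have happ (i j : ι) (x : M) : P i (P j x) = if i = j then P j x else 0 := by
    split_ifs with hij
    · subst hij
      exact congrArg (· x) (hP.idem i).eq
    · exact congrArg (· x) (hP.ortho hij)
  have hind : iSupIndep fun i => LinearMap.range (P i) := by
    intro i
    rw [Submodule.disjoint_def]
    rintro _ ⟨x, rfl⟩ hx
    have hle : ⨆ j, ⨆ (_ : j ≠ i), LinearMap.range (P j) ≤ LinearMap.ker (P i) := by
      refine iSup₂_le fun j hj => ?_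
      rintro _ ⟨y, rfl⟩
      simp [happ, hj.symm]
    simpa [happ] using hle hx
  let K : Submodule R M := LinearMap.ker (∑ i, P i)
  have hle : ⨆ i, LinearMap.range (P i) ≤ LinearMap.eqLocus (∑ i, P i) LinearMap.id := by
    refine iSup_le fun j => ?_
    rintro _ ⟨y, rfl⟩
    simp [happ]
  have hdis : Disjoint K (⨆ i, LinearMap.range (P i)) := by
    rw [Submodule.disjoint_def]
    intro x hx hx'
    exact (show (∑ i, P i) x = x from hle hx').symm.trans hx
  have hsup : K ⊔ ⨆ i, LinearMap.range (P i) = ⊤ := by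
    refine eq_top_iff.2 fun x _ => ?_
    have hmem : (∑ i, P i) x ∈ ⨆ i, LinearMap.range (P i) := by
      rw [LinearMap.sum_apply]
      exact Submodule.sum_mem _ fun i _ =>
        Submodule.mem_iSup_of_mem (p := fun i => LinearMap.range (P i)) i ⟨x, rfl⟩
    refine Submodule.mem_sup.2 ⟨x - (∑ i, P i) x, ?_, _, hmem, sub_add_cancel _ _⟩
    rw [LinearMap.mem_ker, map_sub, sub_eq_zero]
    exact (hle hmem).symm
  have hbot (i : ι) : LinearMap.range (P i) ≠ ⊥ := fun h0 => hne i (LinearMap.range_eq_bot.1 h0)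
  let s : Finset (Submodule R M) := Finset.univ.image fun i => LinearMap.range (P i)
  have hs : s.sup id = ⨆ i, LinearMap.range (P i) := by
    rw [Finset.sup_image, Finset.sup_univ_eq_iSup]
    rfl
  have hsind : s.SupIndep id :=
    (iSupIndep_iff_supIndep_univ.1 hind : Finset.univ.SupIndep (id ∘ _)).image
  -- `K` may be zero, so `⊥` is erased; the ranges survive, being nonzero, and are distinct by
  -- independence.
  let Q : Finpartition (⊤ : Submodule R M) := Finpartition.ofErase (insert K s)
    (hsind.insert (by rwa [hs])) (by rw [Finset.sup_insert, hs]; exact hsup)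
  refine le_trans ?_ (Q.card_le_numIndecomposableSummands h)
  rw [← Finset.card_univ, ← Finset.card_image_of_injective _ (hind.injective hbot)]
  refine Finset.card_le_card fun N hN => Finset.mem_erase.2 ⟨?_, Finset.mem_insert_of_mem hN⟩
  obtain ⟨i, -, rfl⟩ := Finset.mem_image.1 hN
  exact hbot i

end IndecomposableSummands

/-! ### Equivariant operators from averaging over units. -/

section Averaging

variable {k E X : Type*} [Field k] [Monoid E] [AddCommGroup X] [Module k X]

/-- The operator `x ↦ ∑ f (h⁻¹ x) • h w`, summed over the units `h` of a finite monoid. -/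
noncomputable def unitsAverage [Fintype Eˣ] (φ : E →* Module.End k X) (w : X) (f : Module.Dual k X) :
    Module.End k X :=
  ∑ h : Eˣ, (f ∘ₗ φ ↑h⁻¹).smulRight (φ h w)

variable [Fintype Eˣ] (φ : E →* Module.End k X)

theorem unitsAverage_apply (w : X) (f : Module.Dual k X) (x : X) :
    unitsAverage φ w f x = ∑ h : Eˣ, f (φ ↑h⁻¹ x) • φ h w := by
  simp [unitsAverage]

/-- A unit `e` only reindexes the sum. For a nonunit `e`, all `e * h` and `h⁻¹ * e` are nonunits, so
both sides vanish. -/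
theorem unitsAverage_map {w : X} {f : Module.Dual k X}
    (hw : ∀ e : E, ¬ IsUnit e → φ e w = 0) (hf : ∀ e : E, ¬ IsUnit e → ∀ x, f (φ e x) = 0)
    (e : E) (x : X) : unitsAverage φ w f (φ e x) = φ e (unitsAverage φ w f x) := by
  have hmul (a b : E) (y : X) : φ a (φ b y) = φ (a * b) y := by rw [map_mul]; rfl
  simp only [unitsAverage_apply, map_sum, map_smul, hmul]
  by_cases he : IsUnit e
  · obtain ⟨g, rfl⟩ := he
    refine Fintype.sum_equiv (Equiv.mulLeft g⁻¹) _ _ fun h => ?_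
    simp [← Units.val_mul]
  · have h1 (h : Eˣ) : ¬ IsUnit (e * (h : E)) := by simpa using he
    have h2 (h : Eˣ) : ¬ IsUnit (((h⁻¹ : Eˣ) : E) * e) := by simpa using he
    simp only [hw _ (h1 _), hf _ (h2 _), zero_smul, smul_zero]

/-- Terms outside `Z` vanish by `hG`. For `h ∈ Z` and `i = j` the scalars of `h⁻¹` and `h` cancel,
leaving `|Z|` copies of `w j`. -/
theorem smul_unitsAverage_apply_eq_ite {ι : Type*} [DecidableEq ι] (Z : Finset Eˣ)
    (hZ : (Z.card : k) ≠ 0) (hscalar : ∀ z ∈ Z, ∃ c : k, φ z = c • 1) (hZinv : ∀ g ∈ Z, g⁻¹ ∈ Z)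
    (w : ι → X) (f : ι → Module.Dual k X)
    (hwf : ∀ i j, f i (w j) = if i = j then 1 else 0)
    (hG : ∀ g : Eˣ, g ∉ Z → ∀ i j, f i (φ g (w j)) = 0) (i j : ι) :
    (Z.card : k)⁻¹ • unitsAverage φ (w i) (f i) (w j) = if i = j then w j else 0 := by
  classical
  have hterm (h : Eˣ) : f i (φ ↑h⁻¹ (w j)) • φ h (w i) =
      if h ∈ Z then (if i = j then w j else 0) else 0 := by
    split_ifs with hh hij
    · subst hij
      obtain ⟨c, hc⟩ := hscalar _ (hZinv _ hh)
      have : φ h (φ ↑h⁻¹ (w i)) = w i := by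
        rw [← Module.End.mul_apply, ← map_mul]; simp
      rw [hc] at this
      rw [hc]
      simpa [hwf] using this
    · obtain ⟨c, hc⟩ := hscalar _ (hZinv _ hh)
      rw [hc]
      simp [hwf, hij]
    · rw [hG _ (fun h' => hh (by simpa using hZinv _ h')), zero_smul]
  rw [unitsAverage_apply, Finset.sum_congr rfl fun h _ => hterm h, Finset.sum_ite_mem,
    Finset.univ_inter, Finset.sum_const, ← Nat.cast_smul_eq_nsmul k, smul_smul,
    inv_mul_cancel₀ hZ, one_smul]

/-- The image of the `j`-th operator is spanned by translates `h (w j)`. The `i`-th operator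
commutes with `h`, so its values on the `w j` decide the composite. -/
theorem orthogonalIdempotents_smul_unitsAverage {ι : Type*} [DecidableEq ι] (a : k)
    (w : ι → X) (f : ι → Module.Dual k X)
    (hfix : ∀ i j, a • unitsAverage φ (w i) (f i) (w j) = if i = j then w j else 0)
    (hw : ∀ (e : E), ¬ IsUnit e → ∀ i, φ e (w i) = 0)
    (hf : ∀ (e : E), ¬ IsUnit e → ∀ i x, f i (φ e x) = 0) :
    OrthogonalIdempotents fun i => a • unitsAverage φ (w i) (f i) := by
  have hcomp (i j : ι) (x : X) : a • unitsAverage φ (w i) (f i)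
      (unitsAverage φ (w j) (f j) x) = if i = j then unitsAverage φ (w j) (f j) x else 0 := by
    rw [unitsAverage_apply φ (w j), map_sum, Finset.smul_sum]
    have hterm (h : Eˣ) : a • unitsAverage φ (w i) (f i)
        (f j (φ ↑h⁻¹ x) • φ h (w j)) =
        if i = j then f j (φ ↑h⁻¹ x) • φ h (w j) else 0 := by
      rw [map_smul, unitsAverage_map φ (fun e he => hw e he i) (fun e he => hf e he i),
        smul_comm, ← map_smul, hfix]
      split_ifs <;> simp
    rw [Finset.sum_congr rfl fun h _ => hterm h]
    split_ifs <;> simp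
  refine ⟨fun i => ?_, fun i j hij => ?_⟩
  · ext x
    simp [hcomp]
  · ext x
    simp [hcomp, hij]

end Averaging

/-- A finite group of scalars has order invertible in the field. -/
theorem Subgroup.natCast_card_ne_zero_of_forall_scalar {k G A : Type*} [Field k] [Group G] [Finite G]
    [Ring A] [Algebra k A] (φ : G →* A) (hφ : Function.Injective φ)
    (H : Subgroup G) (h : ∀ z ∈ H, ∃ c : k, φ z = algebraMap k A c) : (Nat.card H : k) ≠ 0 := by
  intro h0
  have hcard : (ringChar k) ∣ Nat.card H := ringChar.dvd h0
  have hp0 : ringChar k ≠ 0 := fun hp => Nat.card_pos.ne' (Nat.eq_zero_of_zero_dvd (hp ▸ hcard))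
  have : NeZero (ringChar k) := ⟨hp0⟩
  have hp : Fact (ringChar k).Prime := CharP.char_is_prime_of_pos k (ringChar k)
  -- Cauchy gives a scalar `c` of order `p = ringChar k`, but `c ^ p = 1` forces `c = 1` by
  -- injectivity of Frobenius.
  obtain ⟨z, hz⟩ := exists_prime_orderOf_dvd_card' (ringChar k) hcard
  have hz1 : z ^ ringChar k = 1 := hz ▸ pow_orderOf_eq_one z
  obtain ⟨c, hc⟩ := h z z.2
  rcases subsingleton_or_nontrivial A with hA | hA
  · have : z = 1 := Subtype.ext (hφ (Subsingleton.elim _ _))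
    rw [this, orderOf_one] at hz
    exact hp.out.one_lt.ne hz
  have hcp : c ^ ringChar k = 1 := by
    apply FaithfulSMul.algebraMap_injective k A
    rw [map_pow, ← hc, ← map_pow, map_one, ← Subgroup.coe_pow, hz1, Subgroup.coe_one, map_one]
  have hc1 : c = 1 := by
    apply frobenius_inj k (ringChar k)
    simpa [frobenius_def] using hcp
  have : z = 1 := Subtype.ext (hφ (by rw [hc, hc1, map_one, Subgroup.coe_one, map_one]))
  rw [this, orderOf_one] at hz
  exact hp.out.one_lt.ne hz

/-! ### Vectors and functionals separating a single endomorphism. -/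

section Separation

variable {k V : Type*} [Field k] [AddCommGroup V] [Module k V]

theorem Module.exists_dual_apply_eq_one_of_notMem {p : Submodule k V} {v : V} (hv : v ∉ p) :
    ∃ f : Module.Dual k V, f v = 1 ∧ ∀ x ∈ p, f x = 0 := by
  obtain ⟨f, hf, hp⟩ := Submodule.exists_le_ker_of_notMem hv
  exact ⟨(f v)⁻¹ • f, by simp [hf], fun x hx => by simp [LinearMap.mem_ker.1 (hp hx)]⟩

/-- Otherwise `v` and `T v` are dependent for every `v`, which makes `T` a scalar. -/
theorem Module.End.exists_notMem_span_apply {T : Module.End k V}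
    (hns : ∀ c : k, T ≠ algebraMap k _ c) : ∃ v, v ∉ Submodule.span k {T v} := by
  by_contra! hmem
  obtain ⟨c, hc⟩ := T.exists_eq_smul_id_of_forall_notLinearIndependent fun v => by
    intro hli
    obtain ⟨a, ha⟩ := Submodule.mem_span_singleton.1 (hmem v)
    have := LinearIndependent.pair_iff.1 hli 1 (-a) (by simp [ha])
    exact one_ne_zero this.1
  exact hns c (by rw [hc]; rfl)

/-- An injective map is left cancellable, and left cancellable elements of a finite monoid are
units. -/
theorem Submonoid.isUnit_of_injective (E : Submonoid (Module.End k V)) [Finite E] {e : E}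
    (he : Function.Injective (e : Module.End k V)) : IsUnit e := by
  refine IsLeftRegular.isUnit_of_finite fun a b hab => Subtype.ext (LinearMap.ext fun x => he ?_)
  exact congrArg (fun g : E => (g : Module.End k V) x) hab

theorem Module.exists_dual_apply_eq_one {v : V} (hv : v ≠ 0) :
    ∃ f : Module.Dual k V, f v = 1 :=
  (exists_dual_apply_eq_one_of_notMem (p := ⊥) (by simpa using hv)).imp fun _ h => h.1

/-- Two pairs are needed for a nonunit: one has its vector in the kernel, the other has its
functional vanishing on the range. A single pair with `f w = 1` cannot do both when the kernel lies
in the range. -/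
theorem Submonoid.exists_separating_pair [Nontrivial V] [FiniteDimensional k V]
    (E : Submonoid (Module.End k V)) [Finite E] (e : E) :
    ∃ (w : Bool → V) (f : Bool → Module.Dual k V), (∀ a, f a (w a) = 1) ∧
      (¬ IsUnit e → (e : Module.End k V) (w true) = 0 ∧
        ∀ x, f false ((e : Module.End k V) x) = 0) ∧
      (IsUnit e → (∀ c : k, (e : Module.End k V) ≠ algebraMap k _ c) →
        f true ((e : Module.End k V) (w true)) = 0) := by
  have combine (w₁ w₂ : V) (f₁ f₂ : Module.Dual k V) (h₁ : f₁ w₁ = 1) (h₂ : f₂ w₂ = 1) :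
      ∀ a : Bool, (fun a => cond a f₁ f₂) a ((fun a => cond a w₁ w₂) a) = 1 := by
    rintro (_ | _) <;> assumption
  by_cases he : IsUnit e
  · by_cases hns : ∀ c : k, (e : Module.End k V) ≠ algebraMap k _ c
    · obtain ⟨v, hv⟩ := Module.End.exists_notMem_span_apply hns
      obtain ⟨f, hf, hf0⟩ := Module.exists_dual_apply_eq_one_of_notMem hv
      exact ⟨_, _, combine v v f f hf hf, fun h => absurd he h,
        fun _ _ => hf0 _ (Submodule.mem_span_singleton_self _)⟩
    · obtain ⟨v, hv⟩ := exists_ne (0 : V)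
      obtain ⟨f, hf⟩ := Module.exists_dual_apply_eq_one (k := k) hv
      exact ⟨_, _, combine v v f f hf hf, fun h => absurd he h, fun _ h => absurd h hns⟩
  · have hinj : ¬ Function.Injective (e : Module.End k V) :=
      fun h => he (E.isUnit_of_injective h)
    have hsurj : ¬ Function.Surjective (e : Module.End k V) :=
      fun h => hinj (LinearMap.injective_iff_surjective.2 h)
    obtain ⟨v, hv, hv0⟩ := (Submodule.ne_bot_iff _).1 (mt LinearMap.ker_eq_bot.1 hinj)
    obtain ⟨f, hf⟩ := Module.exists_dual_apply_eq_one (k := k) hv0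
    obtain ⟨u, hu⟩ := not_forall.1 hsurj
    obtain ⟨g, hg, hg0⟩ := Module.exists_dual_apply_eq_one_of_notMem
      (p := LinearMap.range (e : Module.End k V)) (v := u) hu
    exact ⟨_, _, combine v u f g hf hg, fun _ => ⟨hv, fun x => hg0 _ ⟨x, rfl⟩⟩,
      fun h => absurd h he⟩

end Separation

/-! ### Dual families in tensor powers and the lower bound. -/

section TensorPowers

variable {k V : Type*} [Field k] [AddCommGroup V] [Module k V]

/-- The diagonal action of a monoid of endomorphisms on a tensor power. -/
noncomputable def Submonoid.tensorPower (E : Submonoid (Module.End k V)) (n : ℕ) :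
    E →* Module.End k (⨂[k]^n V) where
  toFun e := PiTensorProduct.map fun _ => (e : Module.End k V)
  map_one' := PiTensorProduct.map_one
  map_mul' _ _ := PiTensorProduct.map_mul _ _

theorem Submonoid.tensorPower_tprod (E : Submonoid (Module.End k V)) {n : ℕ} (e : E)
    (v : Fin n → V) : E.tensorPower n e (PiTensorProduct.tprod k v) =
      PiTensorProduct.tprod k fun i => (e : Module.End k V) (v i) :=
  PiTensorProduct.map_tprod _ _

theorem semigroupRep_tensorPower_apply {S : Type*} [Semigroup S] (ρ : S →ₙ* Module.End k V)
    (n : ℕ) (s : WithOne S) : semigroupRep (semigroupTensorPower ρ n) s =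
      PiTensorProduct.map fun _ => semigroupRep ρ s := by
  induction s with
  | one => rw [map_one, map_one]; exact PiTensorProduct.map_one.symm
  | coe s => rfl

theorem TensorPower.finrank_eq [FiniteDimensional k V] (n : ℕ) :
    Module.finrank k (⨂[k]^n V) = Module.finrank k V ^ n := by
  rw [Module.finrank_eq_card_basis (Basis.piTensorProduct fun _ : Fin n => Module.finBasis k V)]
  simp

theorem Representation.length_asModule_le {G : Type*} [Monoid G] [FiniteDimensional k V]
    (σ : Representation k G V) :
    Module.length (MonoidAlgebra k G) σ.asModule ≤ Module.finrank k V := by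
  have h := Submodule.length_le_length_restrictScalars k
    (⊤ : Submodule (MonoidAlgebra k G) σ.asModule)
  rw [Module.length_top, Submodule.restrictScalars_top, Module.length_top,
    Module.length_eq_finrank, σ.asModuleEquiv.finrank_eq] at h
  exact h

theorem Representation.card_le_numIndecomposableSummands {G ι : Type*} [Monoid G] [Fintype ι]
    [FiniteDimensional k V] (σ : Representation k G V) {T : ι → Module.End k V}
    (hT : OrthogonalIdempotents T) (hne : ∀ i, T i ≠ 0)
    (hcomm : ∀ i g x, T i (σ g x) = σ g (T i x)) :
    Fintype.card ι ≤ numIndecomposableSummands (MonoidAlgebra k G) σ.asModule := by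
  let P (i : ι) : Module.End (MonoidAlgebra k G) σ.asModule :=
    MonoidAlgebra.equivariantOfLinearOfComm (σ.asModuleEquiv.symm.conj (T i)) fun g v => by
      rw [Representation.single_smul, Representation.single_smul, one_smul, one_smul]
      exact hcomm i g (σ.asModuleEquiv v)
  have hP (i : ι) (x : σ.asModule) : P i x = T i x := rfl
  refine OrthogonalIdempotents.card_le_numIndecomposableSummands
    (ne_top_of_le_ne_top (ENat.natCast_ne_top _) σ.length_asModule_le) (P := P)
    ⟨fun i => LinearMap.ext fun x => ?_, fun i j hij => LinearMap.ext fun x => ?_⟩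
    fun i h0 => hne i (LinearMap.ext fun x => congrArg (· x) h0)
  · exact congrArg (· x) (hT.idem i).eq
  · exact congrArg (· x) (hT.ortho hij)

/-- The invertible scalars in a monoid of endomorphisms. -/
def Submonoid.scalarUnits (E : Submonoid (Module.End k V)) : Subgroup Eˣ :=
  (Units.map (algebraMap k (Module.End k V)).toMonoidHom).range.comap (Units.map E.subtype)

theorem Submonoid.mem_scalarUnits [Nontrivial V] {E : Submonoid (Module.End k V)} {g : Eˣ} :
    g ∈ E.scalarUnits ↔ ∃ c : k, ((g : E) : Module.End k V) = algebraMap k _ c := by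
  constructor
  · rintro ⟨u, hu⟩
    exact ⟨u, congrArg Units.val hu.symm⟩
  · rintro ⟨c, hc⟩
    have hc0 : c ≠ 0 := by
      rintro rfl
      have := (Units.map E.subtype g).ne_zero
      exact this (hc.trans (map_zero _))
    exact ⟨Units.mk0 c hc0, Units.ext hc.symm⟩

theorem Submonoid.natCast_card_scalarUnits_ne_zero [Nontrivial V]
    (E : Submonoid (Module.End k V)) [Finite E] : (Nat.card E.scalarUnits : k) ≠ 0 :=
  Subgroup.natCast_card_ne_zero_of_forall_scalar (E.subtype.comp (Units.coeHom E))
    (fun _ _ h => Units.ext (Subtype.ext h)) _ fun _ hz => Submonoid.mem_scalarUnits.1 hz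

theorem Submonoid.tensorPower_eq_smul_one {E : Submonoid (Module.End k V)} {e : E} {c : k}
    (h : (e : Module.End k V) = algebraMap k _ c) (n : ℕ) : E.tensorPower n e = c ^ n • 1 := by
  refine PiTensorProduct.ext (MultilinearMap.ext fun v => ?_)
  have : (fun i => (e : Module.End k V) (v i)) = fun i => c • v i := by
    funext i
    rw [h, Module.algebraMap_end_apply]
  simp only [LinearMap.compMultilinearMap_apply, tensorPower_tprod, this]
  rw [MultilinearMap.map_smul_univ]
  simp

/-- A finite monoid of endomorphisms of a nonzero space has, after tensoring with a fixed tensor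
power, dual families such that singular elements kill the vectors and the functionals, and that the
matrix coefficients of nonscalar units vanish. -/
theorem Submonoid.exists_dual_families [FiniteDimensional k V] [Nontrivial V]
    (E : Submonoid (Module.End k V)) [Finite E] : ∃ m : ℕ, ∀ n : ℕ,
      ∃ (w : (Fin n → Fin (Module.finrank k V)) → ⨂[k]^(m + n) V)
        (f : (Fin n → Fin (Module.finrank k V)) → Module.Dual k (⨂[k]^(m + n) V)),
        (∀ i j, f i (w j) = if i = j then 1 else 0) ∧
        (∀ g : Eˣ, g ∉ E.scalarUnits → ∀ i j, f i (E.tensorPower (m + n) g (w j)) = 0) ∧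
        (∀ e : E, ¬ IsUnit e → ∀ i, E.tensorPower (m + n) e (w i) = 0) ∧
        ∀ e : E, ¬ IsUnit e → ∀ i x, f i (E.tensorPower (m + n) e x) = 0 := by
  choose w f hwf hsing hsep using E.exists_separating_pair
  let σ : Fin (Nat.card (E × Bool)) ≃ E × Bool := (Finite.equivFin (E × Bool)).symm
  let b := Module.finBasis k V
  -- There is one tensor factor per element of `E` and per slot. Pairings of pure tensors are
  -- products over the factors, so the factor belonging to `e` alone makes the required expression
  -- vanish.
  refine ⟨Nat.card (E × Bool), fun n => ?_⟩
  let u (j : Fin n → Fin (Module.finrank k V)) : Fin (Nat.card (E × Bool) + n) → V :=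
    Fin.append (fun a => w (σ a).1 (σ a).2) (fun a => b (j a))
  let g (j : Fin n → Fin (Module.finrank k V)) :
      Fin (Nat.card (E × Bool) + n) → Module.Dual k V :=
    Fin.append (fun a => f (σ a).1 (σ a).2) (fun a => b.coord (j a))
  have hu (j) (p : E × Bool) : u j (Fin.castAdd n (σ.symm p)) = w p.1 p.2 := by simp [u]
  have hg (j) (p : E × Bool) (x : V) : g j (Fin.castAdd n (σ.symm p)) x = f p.1 p.2 x := by
    simp [g]
  refine ⟨fun j => PiTensorProduct.tprod k (u j),
    fun j => PiTensorProduct.dualDistrib (PiTensorProduct.tprod k (g j)), fun i j => ?_,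
    fun s hs i j => ?_, fun e he i => ?_, fun e he i x => ?_⟩
  · rw [PiTensorProduct.dualDistrib_apply, Fin.prod_univ_add]
    simp only [Fin.append_left, Fin.append_right, hwf, Finset.prod_const_one, one_mul,
      Module.Basis.coord_apply, Module.Basis.repr_self, Finsupp.single_apply]
    rw [Finset.prod_ite_zero]
    simp [funext_iff, eq_comm]
  · rw [tensorPower_tprod, PiTensorProduct.dualDistrib_apply]
    refine Finset.prod_eq_zero (Finset.mem_univ (Fin.castAdd n (σ.symm (↑s, true)))) ?_
    rw [hu]
    refine (hg _ _ _).trans ?_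
    exact hsep _ s.isUnit fun c hc => hs (mem_scalarUnits.2 ⟨c, hc⟩)
  · rw [tensorPower_tprod]
    refine MultilinearMap.map_coord_zero _ (Fin.castAdd n (σ.symm (e, true))) ?_
    rw [hu]
    exact (hsing e he).1
  · suffices h : PiTensorProduct.dualDistrib (PiTensorProduct.tprod k (g i)) ∘ₗ
        E.tensorPower _ e = 0 from congrArg (· x) h
    refine PiTensorProduct.ext (MultilinearMap.ext fun v => ?_)
    simp only [LinearMap.compMultilinearMap_apply, LinearMap.comp_apply, LinearMap.zero_apply]
    rw [tensorPower_tprod, PiTensorProduct.dualDistrib_apply]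
    refine Finset.prod_eq_zero (Finset.mem_univ (Fin.castAdd n (σ.symm (e, false)))) ?_
    exact (hg _ _ _).trans ((hsing e he).2 _)

/-- The action factors through the finite image `E`, so the averaged operators over `Eˣ` are module
endomorphisms. There is one idempotent for each of the `d ^ n` basis tensors, nonzero because it
fixes `w i`. -/
theorem exists_pow_finrank_le_summandCount {S : Type*} [Semigroup S] [Finite S]
    [FiniteDimensional k V] [Nontrivial V] (ρ : S →ₙ* Module.End k V) :
    ∃ m : ℕ, ∀ n, Module.finrank k V ^ n ≤ summandCount ρ (m + n) := by
  classical
  let E : Submonoid (Module.End k V) := MonoidHom.mrange (semigroupRep ρ)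
  have : Finite (WithOne S) := inferInstanceAs (Finite (Option S))
  have : Finite E := (Set.finite_range (semigroupRep ρ)).to_subtype
  have : Fintype Eˣ := Fintype.ofFinite _
  obtain ⟨m, hm⟩ := E.exists_dual_families
  refine ⟨m, fun n => ?_⟩
  obtain ⟨w, f, hwf, hG, hw, hf⟩ := hm n
  let Z : Finset Eˣ := Finset.univ.filter (· ∈ E.scalarUnits)
  have hmem (g : Eˣ) : g ∈ Z ↔ g ∈ E.scalarUnits := by simp [Z]
  have hZ : (Z.card : k) ≠ 0 := by
    have := E.natCast_card_scalarUnits_ne_zero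
    rwa [Nat.card_eq_fintype_card, Fintype.card_subtype] at this
  have hfix := smul_unitsAverage_apply_eq_ite (E.tensorPower (m + n)) Z hZ
    (fun z hz => (Submonoid.mem_scalarUnits.1 ((hmem z).1 hz)).imp'
      (· ^ (m + n)) fun c hc => Submonoid.tensorPower_eq_smul_one hc _)
    (fun g hg => (hmem _).2 (inv_mem ((hmem g).1 hg))) w f hwf
    (fun g hg => hG g (mt (hmem g).2 hg))
  have horth := orthogonalIdempotents_smul_unitsAverage (E.tensorPower (m + n))
    (Z.card : k)⁻¹ w f hfix hw hf
  have hcard := Representation.card_le_numIndecomposableSummands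
    (semigroupRep (semigroupTensorPower ρ (m + n))) horth ?_ ?_
  · rw [Fintype.card_fun, Fintype.card_fin, Fintype.card_fin] at hcard
    exact hcard
  · intro i h0
    have hwi : w i = 0 :=
      (if_pos rfl).symm.trans ((hfix i i).symm.trans (LinearMap.congr_fun h0 (w i)))
    simpa [hwi] using hwf i i
  · intro i s x
    rw [semigroupRep_tensorPower_apply]
    have := unitsAverage_map (E.tensorPower (m + n)) (fun e he => hw e he i)
      (fun e he => hf e he i) ⟨semigroupRep ρ s, s, rfl⟩ x
    rw [LinearMap.smul_apply, LinearMap.smul_apply, map_smul]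
    exact congrArg _ this

end TensorPowers

/-! ### The asymptotic bounds. -/

theorem proposition2p1 {k S V : Type*} [Field k] [Semigroup S] [Finite S]
    [AddCommGroup V] [Module k V] [FiniteDimensional k V] (ρ : S →ₙ* Module.End k V) :
    InThetaPrime (fun n => (summandCount ρ n : ℝ)) (fun n => (Module.finrank k V : ℝ) ^ n) ∧
    InThetaPrime (fun n => (lengthCount ρ n : ℝ)) (fun n => (Module.finrank k V : ℝ) ^ n) ∧
    ∀ n : ℕ, summandCount ρ n ≤ lengthCount ρ n := by
  have hlen (n : ℕ) : Module.length (MonoidAlgebra k (WithOne S))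
      (semigroupRep (semigroupTensorPower ρ n)).asModule ≤ (Module.finrank k V ^ n : ℕ) := by
    rw [← TensorPower.finrank_eq]
    exact Representation.length_asModule_le _
  have hbl (n : ℕ) : summandCount ρ n ≤ lengthCount ρ n :=
    numIndecomposableSummands_le_length (ne_top_of_le_ne_top (ENat.natCast_ne_top _) (hlen n))
  have hl (n : ℕ) : (lengthCount ρ n : ℝ) ≤ (Module.finrank k V : ℝ) ^ n := by
    have : lengthCount ρ n ≤ Module.finrank k V ^ n := ENat.toNat_le_of_le_natCast (hlen n)
    exact_mod_cast this
  have hb (n : ℕ) : (summandCount ρ n : ℝ) ≤ lengthCount ρ n := by exact_mod_cast hbl n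
  obtain ⟨A, hA, n₀, h⟩ : ∃ A : ℝ, 0 < A ∧ ∃ n₀ : ℕ, ∀ n : ℕ, n₀ < n →
      A * (Module.finrank k V : ℝ) ^ n ≤ summandCount ρ n := by
    rcases subsingleton_or_nontrivial V with hV | hV
    -- If `V = 0`, then `0 ^ n = 0` for `n > 0`, so the lower bound is trivial.
    · refine ⟨1, one_pos, 0, fun n hn => ?_⟩
      simp [Module.finrank_zero_of_subsingleton, hn.ne']
    · obtain ⟨m, hm⟩ := exists_pow_finrank_le_summandCount ρ
      have hd : (0 : ℝ) < (Module.finrank k V : ℝ) ^ m :=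
        pow_pos (Nat.cast_pos.2 Module.finrank_pos) m
      -- The constant `d⁻ᵐ` pays for the `m` factors spent on separation.
      refine ⟨((Module.finrank k V : ℝ) ^ m)⁻¹, inv_pos.2 hd, m, fun n hn => ?_⟩
      obtain ⟨l, rfl⟩ := Nat.exists_eq_add_of_le hn.le
      rw [pow_add, inv_mul_cancel_left₀ hd.ne']
      exact_mod_cast hm l
  exact ⟨⟨A, hA, n₀, fun n hn => ⟨h n hn, (hb n).trans (hl n)⟩⟩,
    ⟨A, hA, n₀, fun n hn => ⟨(h n hn).trans (hb n), hl n⟩⟩, hbl⟩
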